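/- Let $a_1,a_3,a_4,a_6\in\mathbb R$ and consider the reversible reduced Kukles system $$(K_0)\qquad \dot x=-y,\qquad \dot y = x+a_1x^2+a_3y^2+a_4x^3+a_6xy^2 .$$ The origin is a center of $(K_0)$: every point other than the origin in some neighbourhood of the origin lies on a nonconstant closed orbit. Near the origin, parametrize the closed orbits by their initial points $(x,0)$ with $x>0$ small, and let $T(x)$ be the minimal positive period of the orbit through $(x,0)$. Put $$S_{K_0}=10a_1^2+10a_1a_3+4a_3^2-9a_4-3a_6 .$$ (i) If $S_{K_0}>0$, then the period function is increasing at $0$: there is $\delta>0$ such that the orbits through the points $(x,0)$ with $0<x<\delta$ are closed and fill a punctured neighbourhood of the origin, and $T$ is strictly increasing on $(0,\delta)$. (ii) If $S_{K_0}<0$, then the period function is decreasing at $0$: there is $\delta>0$ such that the orbits through the points $(x,0)$ with $0<x<\delta$ are closed and fill a punctured neighbourhood of the origin, and $T$ is strictly decreasing on $(0,\delta)$. -/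

import Mathlib

open Set Topology

/-- The vector field of the reversible reduced Kukles system
`x' = -y`, `y' = x + a₁ x² + a₃ y² + a₄ x³ + a₆ x y²`. -/
def kuklesField (a₁ a₃ a₄ a₆ : ℝ) (p : ℝ × ℝ) : ℝ × ℝ :=
  (-p.2, p.1 + a₁ * p.1 ^ 2 + a₃ * p.2 ^ 2 + a₄ * p.1 ^ 3 + a₆ * p.1 * p.2 ^ 2)

/-- The trajectory of the autonomous planar field `V` starting at `p` is a (nonconstant) closed
orbit, and `T` is its minimal positive period. -/
def IsMinimalPeriod (V : ℝ × ℝ → ℝ × ℝ) (p : ℝ × ℝ) (T : ℝ) : Prop :=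
  ∃ γ : ℝ → ℝ × ℝ, IsIntegralCurve γ (fun _ => V) ∧ γ 0 = p ∧
    IsLeast {τ : ℝ | 0 < τ ∧ Function.Periodic γ τ} T

/-- The origin is a center of `V`: it is an equilibrium, and every other point of some
neighbourhood of it lies on a nonconstant closed orbit. -/
def IsCenterAtZero (V : ℝ × ℝ → ℝ × ℝ) : Prop :=
  V 0 = 0 ∧ ∃ U ∈ 𝓝 (0 : ℝ × ℝ), ∀ p ∈ U, p ≠ 0 → ∃ T : ℝ, IsMinimalPeriod V p T

/-- `T` is the period function of `V` near the origin, the orbits being parametrized by their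
initial points `(x, 0)` with `0 < x < δ`: the orbit of `(x, 0)` is closed with minimal period
`T x`, and these orbits fill a punctured neighbourhood of the origin. -/
def IsPeriodFunctionNearZero (V : ℝ × ℝ → ℝ × ℝ) (δ : ℝ) (T : ℝ → ℝ) : Prop :=
  (∀ x ∈ Ioo 0 δ, IsMinimalPeriod V (x, 0) (T x)) ∧
    ∃ U ∈ 𝓝 (0 : ℝ × ℝ), ∀ p ∈ U, p ≠ 0 →
      ∃ x ∈ Ioo 0 δ, ∃ γ : ℝ → ℝ × ℝ, IsIntegralCurve γ (fun _ => V) ∧ γ 0 = (x, 0) ∧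
        ∃ t : ℝ, γ t = p

/-- The period function is (strictly) increasing in a neighbourhood of the origin. -/
def PeriodIncreasingAtZero (V : ℝ × ℝ → ℝ × ℝ) : Prop :=
  ∃ δ > 0, ∃ T : ℝ → ℝ, IsPeriodFunctionNearZero V δ T ∧ StrictMonoOn T (Ioo 0 δ)

/-- The period function is (strictly) decreasing in a neighbourhood of the origin. -/
def PeriodDecreasingAtZero (V : ℝ × ℝ → ℝ × ℝ) : Prop :=
  ∃ δ > 0, ∃ T : ℝ → ℝ, IsPeriodFunctionNearZero V δ T ∧ StrictAntiOn T (Ioo 0 δ)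

/-- The quantity `S = 10 a₁² + 10 a₁ a₃ + 4 a₃² - 9 a₄ - 3 a₆`, which is one half of
`5 g''(0)² + 10 g''(0) f(0) + 8 f(0)² - 3 g'''(0) - 6 f'(0)` for
`f x = a₃ + a₆ x` and `g x = x + a₁ x² + a₄ x³`. -/
def kuklesS (a₁ a₃ a₄ a₆ : ℝ) : ℝ :=
  10 * a₁ ^ 2 + 10 * a₁ * a₃ + 4 * a₃ ^ 2 - 9 * a₄ - 3 * a₆

/-! Write the second equation as `y' = g(x) + f(x) y²` with `f = a₃ + a₆ x`, and let `F = ∫ f`. For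
`w = e^{F} y` the quantity `w²/2 + G(x)`, `G = ∫ g e^{2F}`, is conserved. As `G` starts with `x²/2`,
it equals `S²/2` for an analytic coordinate `s = S(x)`. In the `(s, w)` plane the orbits are
circles, and the angle obeys `θ' = 1/m(s)` with `m = s e^{-F}/g`. So the orbit of radius `r` has
period `∫ m(r cos θ) dθ` over `[0, 2π]` (`exists_periodic_orbit`).

Only the even part of `m` contributes to this integral, so a nonzero `m''(0)` decides by its sign
whether the period grows or shrinks with `r` (`strictMonoOn_add_comp_neg`,
`strictMonoOn_integral_cos`). Differentiating `g(X) m = s e^{-F(X)}`, where `X` inverts `S`, gives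
`m''(0) = kuklesS / 6` (`second_deriv_of_relation`). Since `r = S x` increases with `x`, the
monotonicity passes to the initial point. -/

/-! ### Time change and periodic orbits -/

open Filter in
/-- A continuous positive periodic function `c` is the speed of a time change: the scalar equation
`θ' = 1 / c θ` has a solution which is inverse to `θ ↦ ∫ φ in 0..θ, c φ`. -/
theorem exists_timeChange {c : ℝ → ℝ} {p : ℝ} (hc : Continuous c) (hpos : ∀ θ, 0 < c θ)
    (hp : 0 < p) (hper : Function.Periodic c p) :
    ∃ Θ : ℝ → ℝ, StrictMono Θ ∧ Function.Surjective Θ ∧ Θ 0 = 0 ∧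
      (∀ t, Θ (t + ∫ φ in (0 : ℝ)..p, c φ) = Θ t + p) ∧ ∀ t, HasDerivAt Θ (c (Θ t))⁻¹ t := by
  have hint : ∀ a b, IntervalIntegrable c MeasureTheory.volume a b :=
    fun a b => hc.intervalIntegrable a b
  set τ : ℝ → ℝ := fun θ => ∫ φ in (0 : ℝ)..θ, c φ with hτ
  have hτd : ∀ θ, HasDerivAt τ (c θ) θ := fun θ => hc.integral_hasStrictDerivAt 0 θ |>.hasDerivAt
  have hmono : StrictMono τ := strictMono_of_deriv_pos fun θ => by
    rw [(hτd θ).deriv]; exact hpos θ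
  have hcont : Continuous τ := continuous_iff_continuousAt.2 fun θ => (hτd θ).continuousAt
  have hsurj : Function.Surjective τ := hcont.surjective
    (hper.tendsto_atTop_intervalIntegral_of_pos' (hint _ _) hpos hp)
    (hper.tendsto_atBot_intervalIntegral_of_pos' (hint _ _) hpos hp)
  let e : ℝ ≃o ℝ := hmono.orderIsoOfSurjective τ hsurj
  have he : ∀ θ, e θ = τ θ := fun θ => rfl
  have hτ0 : τ 0 = 0 := by simp [hτ]
  have hτp : ∀ θ, τ (θ + p) = τ θ + τ p := fun θ => by
    have h := hper.intervalIntegral_add_eq θ 0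
    rw [zero_add] at h
    simp only [hτ]
    rw [← h, intervalIntegral.integral_add_adjacent_intervals (hint _ _) (hint _ _)]
  refine ⟨e.symm, e.symm.strictMono, e.symm.surjective, ?_, fun t => ?_, fun t => ?_⟩
  · rw [OrderIso.symm_apply_eq, he, hτ0]
  · rw [OrderIso.symm_apply_eq, he, hτp, ← he, e.apply_symm_apply]
  · exact (hτd (e.symm t)).of_local_left_inverse e.symm.continuous.continuousAt (hpos _).ne'
      (Eventually.of_forall fun s => e.apply_symm_apply s)

/-- If `X` and `m` satisfy `X' = m e^{-F(X)}` and `g(X) m = s e^{-F(X)}` then, in the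
coordinates `(s, w)` with `x = X s` and `y = e^{-F(x)} w`, the field
`(-y, g x + f x y²)` is a positive multiple of the rotation field, and its orbits are circles
with period `∫ m (r cos θ) dθ`. -/
theorem exists_periodic_orbit {f g F X m : ℝ → ℝ} {ε r : ℝ} (hF : ∀ x, HasDerivAt F (f x) x)
    (hm : ContinuousOn m (Ioo (-ε) ε)) (hpos : ∀ s ∈ Ioo (-ε) ε, 0 < m s)
    (hinj : InjOn X (Ioo (-ε) ε))
    (hX : ∀ s ∈ Ioo (-ε) ε, HasDerivAt X (m s * Real.exp (-F (X s))) s)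
    (hg : ∀ s ∈ Ioo (-ε) ε, g (X s) * m s = s * Real.exp (-F (X s)))
    (hr : r ∈ Ioo 0 ε) :
    ∃ γ : ℝ → ℝ × ℝ, IsIntegralCurve γ (fun _ p => (-p.2, g p.1 + f p.1 * p.2 ^ 2)) ∧
      γ 0 = (X r, 0) ∧
      IsLeast {τ : ℝ | 0 < τ ∧ Function.Periodic γ τ}
        (∫ θ in (0 : ℝ)..(2 * Real.pi), m (r * Real.cos θ)) ∧
      ∀ θ, ∃ t, γ t = (X (r * Real.cos θ),
        Real.exp (-F (X (r * Real.cos θ))) * (r * Real.sin θ)) := by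
  have hmem : ∀ θ, r * Real.cos θ ∈ Ioo (-ε) ε := fun θ => by
    have h1 := Real.cos_le_one θ
    have h2 := Real.neg_one_le_cos θ
    constructor <;> nlinarith [hr.1, hr.2]
  have hcc : Continuous fun θ => m (r * Real.cos θ) :=
    hm.comp_continuous (by fun_prop) hmem
  obtain ⟨Θ, hmono, hsurj, h0, hper, hder⟩ := exists_timeChange hcc (fun θ => hpos _ (hmem θ))
    Real.two_pi_pos (fun θ => by simp)
  set T := ∫ θ in (0 : ℝ)..(2 * Real.pi), m (r * Real.cos θ) with hT
  have hΘT : Θ T = 2 * Real.pi := by simpa [h0] using hper 0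
  set γ : ℝ → ℝ × ℝ := fun t => (X (r * Real.cos (Θ t)),
    Real.exp (-F (X (r * Real.cos (Θ t)))) * (r * Real.sin (Θ t))) with hγ
  have hγ0 : γ 0 = (X r, 0) := by simp [hγ, h0]
  refine ⟨γ, fun t => ?_, hγ0, ⟨⟨?_, fun t => ?_⟩, fun τ hτ => ?_⟩, fun θ => ?_⟩
  · have hs := ((hder t).cos).const_mul r
    have hw := ((hder t).sin).const_mul r
    have hx := (hX _ (hmem (Θ t))).comp t hs
    have hE := ((hF _).comp t hx).neg.exp
    have hmp := (hpos _ (hmem (Θ t))).ne'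
    have hgg := hg _ (hmem (Θ t))
    have hy := hE.mul hw
    refine (hx.prodMk hy).congr_deriv ?_
    simp only [hγ, Pi.neg_apply, Function.comp_apply] at *
    set E := Real.exp (-F (X (r * Real.cos (Θ t))))
    set M := m (r * Real.cos (Θ t))
    refine Prod.ext ?_ ?_
    · simp only
      field_simp
    · simp only
      field_simp
      linear_combination -hgg
  · rw [← hmono.lt_iff_lt, h0, hΘT]; exact Real.two_pi_pos
  · simp only [hγ, hper t, Real.cos_add_two_pi, Real.sin_add_two_pi]
  -- After a period the orbit is back at its start, where injectivity of `X` forces `cos (Θ τ) = 1`;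
  -- thus `Θ τ` is a positive multiple of `2π = Θ T`.
  · obtain ⟨hτ0, hτp⟩ := hτ
    have h1 : γ τ = (X r, 0) := by rw [← hγ0, ← hτp 0, zero_add]
    have h2 : X (r * Real.cos (Θ τ)) = X r := congrArg Prod.fst h1
    have h3 := hinj (hmem _) ⟨by linarith [hr.1, hr.2], hr.2⟩ h2
    have h4 : Real.cos (Θ τ) = 1 := by
      have := hr.1.ne'
      field_simp at h3
      exact h3
    obtain ⟨n, hn⟩ := (Real.cos_eq_one_iff _).1 h4
    have h5 : 0 < Θ τ := h0 ▸ hmono hτ0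
    have h6 : (0 : ℝ) < n := by
      rw [← hn] at h5
      exact pos_of_mul_pos_left h5 Real.two_pi_pos.le
    have h7 : (1 : ℝ) ≤ n := by exact_mod_cast h6
    rw [← hmono.le_iff_le, hΘT, ← hn]
    nlinarith [Real.two_pi_pos]
  · obtain ⟨t, rfl⟩ := hsurj θ
    exact ⟨t, rfl⟩

/-- Translating time in an autonomous system preserves solutions and their sets of periods. -/
theorem IsMinimalPeriod.of_orbit {V : ℝ × ℝ → ℝ × ℝ} {γ : ℝ → ℝ × ℝ} {T : ℝ}
    (hγ : IsIntegralCurve γ fun _ => V)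
    (hT : IsLeast {τ : ℝ | 0 < τ ∧ Function.Periodic γ τ} T) (t₀ : ℝ) :
    IsMinimalPeriod V (γ t₀) T := by
  refine ⟨fun t => γ (t + t₀), fun t => ?_, by simp, ?_⟩
  · exact HasDerivAt.comp_add_const t t₀ (hγ (t + t₀))
  · convert hT using 3 with τ
    refine and_congr_right fun _ => ⟨fun h t => ?_, fun h t => ?_⟩
    · have := h (t - t₀)
      simp only at this
      rwa [sub_add_cancel, show t - t₀ + τ + t₀ = t + τ by ring] at this
    · simp only
      rw [show t + τ + t₀ = t + t₀ + τ by ring, h]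

/-! ### Analytic primitives and the Morse coordinate -/

/-- An entire function has an entire primitive; its real part on the real axis is real-analytic. -/
theorem Differentiable.exists_analytic_real_primitive {φ : ℂ → ℂ} (hφ : Differentiable ℂ φ) :
    ∃ G : ℝ → ℝ, (∀ x, AnalyticAt ℝ G x) ∧ G 0 = 0 ∧ ∀ x : ℝ, HasDerivAt G (φ x).re x := by
  obtain ⟨P, hP0, hP⟩ := hφ.isExactOn_univ.with_val_at 0 0
  have hPd : ∀ z, HasDerivAt P (φ z) z := fun z => hP z (mem_univ z)
  have hdiff : Differentiable ℂ P := fun z => (hPd z).differentiableAt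
  refine ⟨fun x => (P x).re, fun x => ?_, by simp [hP0], fun x => (hPd x).real_of_complex⟩
  have h1 : AnalyticAt ℝ P (x : ℂ) := (hdiff.analyticAt x).restrictScalars
  have h2 : AnalyticAt ℝ (fun y : ℝ => (y : ℂ)) x := Complex.ofRealCLM.analyticAt x
  exact (Complex.reCLM.analyticAt _).comp (h1.comp h2)

theorem AnalyticAt.dslope_self {f : ℝ → ℝ} {x : ℝ} (hf : AnalyticAt ℝ f x) :
    AnalyticAt ℝ (dslope f x) x := by
  obtain ⟨p, hp⟩ := hf
  exact ⟨_, hp.has_fpower_series_dslope_fslope⟩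

/-- Morse lemma in one variable: if `G' = x q` with `G 0 = 0` and `q 0 = 1`,
then `G = S² / 2` for an analytic coordinate `S` tangent to the identity. -/
theorem exists_analytic_sqrt {G q : ℝ → ℝ} (hG : AnalyticAt ℝ G 0) (hG0 : G 0 = 0)
    (hq : ContinuousAt q 0) (hq0 : q 0 = 1)
    (hd : ∀ᶠ x in 𝓝 0, HasDerivAt G (x * q x) x) :
    ∃ S : ℝ → ℝ, AnalyticAt ℝ S 0 ∧ S 0 = 0 ∧ HasDerivAt S 1 0 ∧
      ∀ᶠ x in 𝓝 0, S x * deriv S x = x * q x := by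
  set G₁ := dslope G 0 with hG₁
  set Q := dslope G₁ 0 with hQ
  have hG₁a : AnalyticAt ℝ G₁ 0 := hG.dslope_self
  have hQa : AnalyticAt ℝ Q 0 := hG₁a.dslope_self
  have hG₁0 : G₁ 0 = 0 := by
    rw [hG₁, dslope_same, hd.self_of_nhds.deriv]; simp
  have hGQ : ∀ x, G x = x ^ 2 * Q x := fun x => by
    have h1 := sub_smul_dslope G 0 x
    have h2 := sub_smul_dslope G₁ 0 x
    simp only [sub_zero, smul_eq_mul, hG0, hG₁0] at h1 h2
    rw [hQ, pow_two, mul_assoc, h2, hG₁, h1]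
  have hQd : ∀ᶠ x in 𝓝 (0 : ℝ), HasDerivAt Q (deriv Q x) x :=
    hQa.eventually_analyticAt.mono fun x hx => hx.differentiableAt.hasDerivAt
  have hrel : ∀ᶠ x in 𝓝[≠] (0 : ℝ), 2 * Q x + x * deriv Q x = q x := by
    filter_upwards [hd.filter_mono nhdsWithin_le_nhds, hQd.filter_mono nhdsWithin_le_nhds,
      self_mem_nhdsWithin] with x hx hQx hne
    have h1 := ((hasDerivAt_pow 2 x).mul hQx).congr_of_eventuallyEq
      (f₁ := G) (Filter.Eventually.of_forall fun y => hGQ y)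
    have h2 := hx.unique h1
    have hne' : x ≠ 0 := hne
    apply mul_left_cancel₀ hne'
    rw [h2]; push_cast; ring
  -- `hrel` was divided by `x`, so it holds only off `0`; continuity carries it to the origin.
  have hQ0 : Q 0 = 1 / 2 := by
    have hc : ContinuousAt (fun x => 2 * Q x + x * deriv Q x) 0 :=
      (continuousAt_const.mul hQa.continuousAt).add (continuousAt_id.mul hQa.deriv.continuousAt)
    have h1 : Filter.Tendsto (fun x => 2 * Q x + x * deriv Q x) (𝓝[≠] 0) (𝓝 (q 0)) :=
      Filter.Tendsto.congr' (hrel.mono fun x hx => hx.symm)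
        (hq.tendsto.mono_left nhdsWithin_le_nhds)
    have h2 := tendsto_nhds_unique (hc.tendsto.mono_left nhdsWithin_le_nhds) h1
    rw [hq0] at h2
    linarith
  have hR : AnalyticAt ℝ (fun x => Real.sqrt (2 * Q x)) 0 := by
    have h1 : AnalyticAt ℝ (fun x => 2 * Q x) 0 := analyticAt_const.mul hQa
    -- Here `⊤` is the analytic class, not merely `C^∞`.
    have h2 : ContDiffAt ℝ ⊤ (fun x => Real.sqrt (2 * Q x)) 0 :=
      h1.contDiffAt.sqrt (by rw [hQ0]; norm_num)
    exact h2.analyticAt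
  have hS : AnalyticAt ℝ (fun x => x * Real.sqrt (2 * Q x)) 0 := analyticAt_id.mul hR
  refine ⟨_, hS, by simp, ?_, ?_⟩
  · have h := (hasDerivAt_id (0 : ℝ)).mul hR.differentiableAt.hasDerivAt
    refine h.congr_deriv ?_
    simp [hQ0]
  · have hQpos : ∀ᶠ x in 𝓝 (0 : ℝ), 0 < Q x :=
      hQa.continuousAt.eventually_const_lt (by rw [hQ0]; norm_num)
    filter_upwards [hd, hS.eventually_analyticAt, hQpos.eventually_nhds] with x hx hSx hpos
    have h1 := hSx.differentiableAt.hasDerivAt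
    have h2 := (h1.mul h1).congr_of_eventuallyEq (f₁ := fun y => 2 * G y) (by
      filter_upwards [hpos] with y hy
      have := Real.mul_self_sqrt (show 0 ≤ 2 * Q y by linarith)
      simp only [Pi.mul_apply]
      rw [hGQ]
      linear_combination -y ^ 2 * this)
    have h3 := (hx.const_mul 2).unique h2
    linarith

/-! ### The Kukles coordinates and `m''(0)` -/

/-- Differentiating `g(X) m = s E` three times at the origin. -/
theorem second_deriv_of_relation {a₁ a₃ a₄ a₆ : ℝ} {X E m m₁ m₂ : ℝ → ℝ} {m₃ : ℝ}
    (hX0 : X 0 = 0) (hE0 : E 0 = 1) (hm0 : m 0 = 1)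
    (hX : ∀ᶠ s in 𝓝 0, HasDerivAt X (m s * E s) s)
    (hE : ∀ᶠ s in 𝓝 0, HasDerivAt E (-((a₃ + a₆ * X s) * (m s * E s)) * E s) s)
    (hm : ∀ᶠ s in 𝓝 0, HasDerivAt m (m₁ s) s) (hm₁ : ∀ᶠ s in 𝓝 0, HasDerivAt m₁ (m₂ s) s)
    (hm₂ : HasDerivAt m₂ m₃ 0)
    (h : ∀ᶠ s in 𝓝 0, (X s + a₁ * X s ^ 2 + a₄ * X s ^ 3) * m s = s * E s) :
    m₂ 0 = kuklesS a₁ a₃ a₄ a₆ / 6 := by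
  have I1 : ∀ᶠ s in 𝓝 0,
      (1 + 2 * a₁ * X s + 3 * a₄ * X s ^ 2) * (m s ^ 2 * E s)
        + (X s + a₁ * X s ^ 2 + a₄ * X s ^ 3) * m₁ s
      = E s - s * ((a₃ + a₆ * X s) * (m s * E s ^ 2)) := by
    filter_upwards [h.eventually_nhds, hX, hE, hm] with s hs hX hE hm
    have hl := ((hX.add ((hX.pow 2).const_mul a₁)).add ((hX.pow 3).const_mul a₄)).mul hm
    have hr := (hasDerivAt_id s).mul hE
    have := hl.unique (hr.congr_of_eventuallyEq hs)
    simp only [Pi.add_apply, Pi.pow_apply, id] at this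
    push_cast at this
    linear_combination this
  have I2 : ∀ᶠ s in 𝓝 0,
      (2 * a₁ + 6 * a₄ * X s) * (m s ^ 3 * E s ^ 2)
        + (1 + 2 * a₁ * X s + 3 * a₄ * X s ^ 2) *
          (3 * (m s * m₁ s * E s) - (a₃ + a₆ * X s) * (m s ^ 3 * E s ^ 2))
        + (X s + a₁ * X s ^ 2 + a₄ * X s ^ 3) * m₂ s
      = -2 * ((a₃ + a₆ * X s) * (m s * E s ^ 2)) - s * (a₆ * (m s ^ 2 * E s ^ 3)
        + (a₃ + a₆ * X s) * (m₁ s * E s ^ 2)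
        - 2 * (a₃ + a₆ * X s) ^ 2 * (m s ^ 2 * E s ^ 3)) := by
    filter_upwards [I1.eventually_nhds, hX, hE, hm, hm₁] with s hs hX hE hm hm₁
    have hf := (hX.const_mul a₆).const_add a₃
    have hg' := ((hX.const_mul (2 * a₁)).const_add 1).add ((hX.pow 2).const_mul (3 * a₄))
    have hl := (hg'.mul ((hm.pow 2).mul hE)).add
      (((hX.add ((hX.pow 2).const_mul a₁)).add ((hX.pow 3).const_mul a₄)).mul hm₁)
    have hr := hE.sub ((hasDerivAt_id s).mul (hf.mul (hm.mul (hE.pow 2))))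
    have := hl.unique (hr.congr_of_eventuallyEq hs)
    simp only [Pi.add_apply, Pi.mul_apply, Pi.pow_apply, id] at this
    push_cast at this
    linear_combination this
  -- As `g(X)` vanishes at `0`, the second derivative of the relation fixes `m'(0)` and the third
  -- fixes `m''(0)`.
  have hm₁0 : 3 * m₁ 0 = -(2 * a₁ + a₃) := by
    have := I2.self_of_nhds
    rw [hX0, hE0, hm0] at this
    linear_combination this
  have hX := hX.self_of_nhds
  have hE := hE.self_of_nhds
  have hm := hm.self_of_nhds
  have hm₁ := hm₁.self_of_nhds
  have hf := (hX.const_mul a₆).const_add a₃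
  have hg' := ((hX.const_mul (2 * a₁)).const_add 1).add ((hX.pow 2).const_mul (3 * a₄))
  have hl := ((((hX.const_mul (6 * a₄)).const_add (2 * a₁)).mul ((hm.pow 3).mul (hE.pow 2))).add
    (hg'.mul ((((hm.mul hm₁).mul hE).const_mul 3).sub
      (hf.mul ((hm.pow 3).mul (hE.pow 2)))))).add
    (((hX.add ((hX.pow 2).const_mul a₁)).add ((hX.pow 3).const_mul a₄)).mul hm₂)
  have hr := ((hf.mul (hm.mul (hE.pow 2))).const_mul (-2)).sub ((hasDerivAt_id (0 : ℝ)).mul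
    (((((hm.pow 2).mul (hE.pow 3)).const_mul a₆).add (hf.mul (hm₁.mul (hE.pow 2)))).sub
      (((hf.pow 2).const_mul 2).mul ((hm.pow 2).mul (hE.pow 3)))))
  have I3 := hl.unique (hr.congr_of_eventuallyEq I2)
  simp only [Pi.add_apply, Pi.mul_apply, Pi.sub_apply, Pi.pow_apply, id, hX0, hE0, hm0] at I3
  push_cast at I3
  unfold kuklesS
  have hm₁0' : m₁ 0 = -(2 * a₁ + a₃) / 3 := by linarith
  rw [hm₁0'] at I3
  -- `m₂ 0` has coefficient `4` in `I3`: three from `m m₁ E`, one from the derivative of `g(X)`.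
  linear_combination I3 / 4

open Filter in
/-- Coordinates near the origin in which the Kukles field is a multiple of the rotation field. -/
theorem exists_kukles_coordinates (a₁ a₃ a₄ a₆ : ℝ) :
    ∃ S X m : ℝ → ℝ, S 0 = 0 ∧ ContinuousAt S 0 ∧ (∀ᶠ x in 𝓝 0, X (S x) = x) ∧ X 0 = 0 ∧
      AnalyticAt ℝ m 0 ∧ m 0 = 1 ∧ ∀ᶠ s in 𝓝 0, S (X s) = s ∧
        HasDerivAt X (m s * Real.exp (-(a₃ * X s + a₆ / 2 * X s ^ 2))) s ∧
        (X s + a₁ * X s ^ 2 + a₄ * X s ^ 3) * m s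
          = s * Real.exp (-(a₃ * X s + a₆ / 2 * X s ^ 2)) := by
  obtain ⟨G, hG, hG0, hGd⟩ := Differentiable.exists_analytic_real_primitive
    (φ := fun z : ℂ => (z * (1 + a₁ * z + a₄ * z ^ 2)) * Complex.exp (2 * (a₃ * z + a₆ / 2 * z ^ 2)))
    (by fun_prop)
  set q : ℝ → ℝ := fun x => (1 + a₁ * x + a₄ * x ^ 2) * Real.exp (2 * (a₃ * x + a₆ / 2 * x ^ 2))
    with hq
  have hGq : ∀ x, HasDerivAt G (x * q x) x := fun x => by
    refine (hGd x).congr_deriv ?_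
    have : ((x : ℂ) * (1 + a₁ * x + a₄ * x ^ 2)) * Complex.exp (2 * (a₃ * x + a₆ / 2 * x ^ 2))
        = ((x * q x : ℝ) : ℂ) := by
      simp only [hq]; push_cast; ring
    rw [this, Complex.ofReal_re]
  obtain ⟨S, hS, hS0, hSd, hSS⟩ := exists_analytic_sqrt (hG 0) hG0
    (q := q) (by fun_prop) (by simp [hq]) (Eventually.of_forall hGq)
  have hd0 : deriv S 0 ≠ 0 := by rw [hSd.deriv]; exact one_ne_zero
  set X := hS.hasStrictDerivAt.localInverse S (deriv S 0) 0 hd0 with hX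
  have hXa : AnalyticAt ℝ X 0 := by
    have := hS.analyticAt_localInverse hd0
    rwa [hS0] at this
  have hl : ∀ᶠ x in 𝓝 0, X (S x) = x :=
    (hS.hasStrictDerivAt.hasStrictFDerivAt_equiv hd0).eventually_left_inverse
  have hr : ∀ᶠ s in 𝓝 0, S (X s) = s := by
    have := (hS.hasStrictDerivAt.hasStrictFDerivAt_equiv hd0).eventually_right_inverse
    rwa [hS0] at this
  have hX0 : X 0 = 0 := by simpa [hS0] using hl.self_of_nhds
  have hXt : Tendsto X (𝓝 0) (𝓝 0) := by simpa [hX0] using hXa.continuousAt.tendsto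
  have hEa : AnalyticAt ℝ (fun s => Real.exp (a₃ * X s + a₆ / 2 * X s ^ 2)) 0 :=
    ((analyticAt_const.mul hXa).add (analyticAt_const.mul (hXa.pow 2))).rexp
  have hma : AnalyticAt ℝ (fun s => deriv X s * Real.exp (a₃ * X s + a₆ / 2 * X s ^ 2)) 0 :=
    hXa.deriv.mul hEa
  have hchain : ∀ᶠ s in 𝓝 0, deriv S (X s) * deriv X s = 1 := by
    filter_upwards [hr.eventually_nhds, hXa.eventually_analyticAt,
      hXt.eventually (by simpa using hS.eventually_analyticAt)] with s hs hXs hSs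
    have h1 := hSs.differentiableAt.hasDerivAt.comp s hXs.differentiableAt.hasDerivAt
    exact h1.unique ((hasDerivAt_id s).congr_of_eventuallyEq hs)
  refine ⟨S, X, _, hS0, hS.continuousAt, hl, hX0, hma, ?_, ?_⟩
  · have := hchain.self_of_nhds
    rw [hX0, hSd.deriv, one_mul] at this
    simp [hX0, this]
  · filter_upwards [hr, hXa.eventually_analyticAt, hchain, hXt.eventually hSS] with s hs hXs hc hq'
    refine ⟨hs, ?_, ?_⟩
    · refine hXs.differentiableAt.hasDerivAt.congr_deriv ?_
      rw [mul_assoc, ← Real.exp_add, add_neg_cancel, Real.exp_zero, mul_one]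
    · rw [hs] at hq'
      simp only [hq, two_mul, Real.exp_add] at hq'
      rw [Real.exp_neg, eq_mul_inv_iff_mul_eq₀ (Real.exp_pos _).ne', Real.exp_add]
      linear_combination (-deriv X s) * hq' + s * hc

/-! ### Monotonicity of circle means -/

/-- The derivative `m'(s) - m'(-s)` vanishes at `0` with slope `2 m''(0) > 0`, so it is positive
just to the right. -/
theorem strictMonoOn_add_comp_neg {m : ℝ → ℝ} (hm : AnalyticAt ℝ m 0)
    (h : 0 < deriv (deriv m) 0) :
    ∃ ε > 0, StrictMonoOn (fun s => m s + m (-s)) (Ico 0 ε) := by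
  have hneg : Filter.Tendsto (fun s : ℝ => -s) (𝓝 0) (𝓝 0) := by
    simpa using (continuous_neg (G := ℝ)).tendsto 0
  have hd : HasDerivAt (deriv m) (deriv (deriv m) 0) 0 :=
    hm.deriv.differentiableAt.hasDerivAt
  have hd' : HasDerivAt (fun s => deriv m s - deriv m (-s)) (2 * deriv (deriv m) 0) 0 := by
    have h1 : HasDerivAt (fun s => deriv m (-s)) (-deriv (deriv m) 0) 0 :=
      by
      have h0 : HasDerivAt (deriv m) (deriv (deriv m) 0) (-0) := by rwa [neg_zero]
      exact (h0.comp 0 (hasDerivAt_neg 0)).congr_deriv (by ring)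
    exact (hd.sub h1).congr_deriv (by ring)
  have hpos : ∀ᶠ s in 𝓝[>] (0 : ℝ), 0 < deriv m s - deriv m (-s) := by
    have h2 := (hasDerivAt_iff_tendsto_slope.1 hd').eventually_const_lt
      (show 0 < 2 * deriv (deriv m) 0 by linarith)
    filter_upwards [h2.filter_mono (nhdsWithin_mono 0 fun x (hx : 0 < x) => ne_of_gt hx),
      self_mem_nhdsWithin] with s hs hs0
    have hs0' : (0 : ℝ) < s := hs0
    simp only [slope, sub_zero, neg_zero, sub_self, vsub_eq_sub, smul_eq_mul] at hs
    exact pos_of_mul_pos_right hs (inv_pos.2 hs0').le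
  have hda : ∀ᶠ s in 𝓝 (0 : ℝ), DifferentiableAt ℝ m s ∧ DifferentiableAt ℝ m (-s) :=
    (hm.eventually_analyticAt.mono fun s hs => hs.differentiableAt).and
      (hneg.eventually (hm.eventually_analyticAt.mono fun s hs => hs.differentiableAt))
  obtain ⟨ε₁, hε₁, h₁⟩ := mem_nhdsGT_iff_exists_Ioo_subset.1 hpos
  obtain ⟨ε₂, hε₂, h₂⟩ := Metric.eventually_nhds_iff.1 hda
  have hdiff : ∀ s ∈ Ico 0 (min ε₁ ε₂),
      HasDerivAt (fun s => m s + m (-s)) (deriv m s - deriv m (-s)) s := fun s hs => by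
    have := @h₂ s (by
      rw [Real.dist_eq, sub_zero, abs_of_nonneg hs.1]
      exact hs.2.trans_le (min_le_right _ _))
    have h3 : HasDerivAt (fun s => m (-s)) (-deriv m (-s)) s :=
      (this.2.hasDerivAt.comp s (hasDerivAt_neg s)).congr_deriv (by ring)
    exact (this.1.hasDerivAt.add h3).congr_deriv (by ring)
  refine ⟨min ε₁ ε₂, lt_min hε₁ hε₂, strictMonoOn_of_deriv_pos (convex_Ico _ _)
    (fun s hs => (hdiff s hs).continuousAt.continuousWithinAt) fun s hs => ?_⟩
  rw [interior_Ico] at hs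
  rw [(hdiff s ⟨hs.1.le, hs.2⟩).deriv]
  exact h₁ ⟨hs.1, hs.2.trans_le (min_le_left _ _)⟩

/-- The mean of `m` over a circle of radius `r` is strictly increasing in `r` when the even part
of `m` is. -/
theorem strictMonoOn_integral_cos {m : ℝ → ℝ} {ε : ℝ} (hm : ContinuousOn m (Ioo (-ε) ε))
    (hmono : StrictMonoOn (fun s => m s + m (-s)) (Ico 0 ε)) :
    StrictMonoOn (fun r => ∫ θ in (0 : ℝ)..(2 * Real.pi), m (r * Real.cos θ)) (Ioo 0 ε) := by
  have hcont : ∀ r ∈ Ioo 0 ε, Continuous fun θ => m (r * Real.cos θ) := fun r hr =>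
    hm.comp_continuous (by fun_prop) fun θ => by
      have h1 := Real.cos_le_one θ
      have h2 := Real.neg_one_le_cos θ
      constructor <;> nlinarith [hr.1, hr.2]
  have hcont' : ∀ r ∈ Ioo 0 ε, Continuous fun θ => m (-(r * Real.cos θ)) := fun r hr => by
    have := (hcont r hr).comp (continuous_id.add (continuous_const (y := Real.pi)))
    simpa [Function.comp_def, Real.cos_add_pi] using this
  -- The shift by `π` negates the cosine and folds the second half circle onto the first.
  have key : ∀ r ∈ Ioo 0 ε, ∫ θ in (0 : ℝ)..(2 * Real.pi), m (r * Real.cos θ)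
      = ∫ θ in (0 : ℝ)..Real.pi, (m (r * Real.cos θ) + m (-(r * Real.cos θ))) := fun r hr => by
    have h1 : ∫ θ in Real.pi..(2 * Real.pi), m (r * Real.cos θ)
        = ∫ θ in (0 : ℝ)..Real.pi, m (-(r * Real.cos θ)) := by
      have := intervalIntegral.integral_comp_add_right (a := 0) (b := Real.pi)
        (fun θ => m (r * Real.cos θ)) Real.pi
      simp only [Real.cos_add_pi, zero_add, ← two_mul, mul_neg] at this
      exact this.symm
    rw [intervalIntegral.integral_add ((hcont r hr).intervalIntegrable _ _)
      ((hcont' r hr).intervalIntegrable _ _), ← h1,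
      intervalIntegral.integral_add_adjacent_intervals ((hcont r hr).intervalIntegrable _ _)
      ((hcont r hr).intervalIntegrable _ _)]
  have heven : ∀ s, m s + m (-s) = m |s| + m (-|s|) := fun s => by
    rcases abs_choice s with h | h <;> rw [h]
    rw [neg_neg, add_comm]
  have hIco : ∀ r ∈ Ioo 0 ε, ∀ θ, |r * Real.cos θ| ∈ Ico 0 ε := fun r hr θ => by
    refine ⟨abs_nonneg _, ?_⟩
    rw [abs_mul, abs_of_pos hr.1]
    nlinarith [Real.abs_cos_le_one θ, hr.1, hr.2]
  intro r hr r' hr' hrr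
  simp only
  rw [key r hr, key r' hr']
  refine intervalIntegral.integral_lt_integral_of_continuousOn_of_le_of_exists_lt Real.pi_pos
    ((hcont r hr).add (hcont' r hr)).continuousOn
    ((hcont r' hr').add (hcont' r' hr')).continuousOn (fun θ _ => ?_)
    ⟨0, ⟨le_rfl, Real.pi_pos.le⟩, ?_⟩
  · rw [heven, heven (r' * _)]
    refine hmono.monotoneOn (hIco r hr θ) (hIco r' hr' θ) ?_
    rw [abs_mul, abs_mul, abs_of_pos hr.1, abs_of_pos hr'.1]
    gcongr
  · simpa using hmono ⟨hr.1.le, hr.2⟩ ⟨hr'.1.le, hr'.2⟩ hrr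

theorem strictAntiOn_integral_cos {m : ℝ → ℝ} {ε : ℝ} (hm : ContinuousOn m (Ioo (-ε) ε))
    (hanti : StrictMonoOn (fun s => -m s + -m (-s)) (Ico 0 ε)) :
    StrictAntiOn (fun r => ∫ θ in (0 : ℝ)..(2 * Real.pi), m (r * Real.cos θ)) (Ioo 0 ε) := by
  have := strictMonoOn_integral_cos (m := fun s => -m s) hm.neg hanti
  simp only [intervalIntegral.integral_neg] at this
  exact fun r hr r' hr' h => neg_lt_neg_iff.1 (this hr hr' h)

/-! ### The period function and the conclusion -/

/-- In a small disc the period of the orbit of `(x, 0)` is the integral of `m` over a circle whose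
radius `S x` increases with `x`. -/
theorem exists_periodFunction (a₁ a₃ a₄ a₆ : ℝ) :
    ∃ m : ℝ → ℝ, AnalyticAt ℝ m 0 ∧ deriv (deriv m) 0 = kuklesS a₁ a₃ a₄ a₆ / 6 ∧
      ∃ ε₀ > 0, ContinuousOn m (Ioo (-ε₀) ε₀) ∧ ∀ ε ∈ Ioo 0 ε₀, ∃ δ > 0, ∃ S : ℝ → ℝ,
        StrictMonoOn S (Ioo 0 δ) ∧ MapsTo S (Ioo 0 δ) (Ioo 0 ε) ∧
        IsPeriodFunctionNearZero (kuklesField a₁ a₃ a₄ a₆) δ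
          (fun x => ∫ θ in (0 : ℝ)..(2 * Real.pi), m (S x * Real.cos θ)) ∧
        IsCenterAtZero (kuklesField a₁ a₃ a₄ a₆) := by
  obtain ⟨S, X, m, hS0, hSc, hl, hX0, hm, hm0, hev⟩ := exists_kukles_coordinates a₁ a₃ a₄ a₆
  have hF : ∀ x : ℝ, HasDerivAt (fun x => a₃ * x + a₆ / 2 * x ^ 2) (a₃ + a₆ * x) x := fun x => by
    refine (((hasDerivAt_id x).const_mul a₃).add
      ((hasDerivAt_pow 2 x).const_mul (a₆ / 2))).congr_deriv ?_
    push_cast; ring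
  refine ⟨m, hm, ?_, ?_⟩
  · have hd : ∀ {h : ℝ → ℝ}, AnalyticAt ℝ h 0 → ∀ᶠ s in 𝓝 (0 : ℝ), HasDerivAt h (deriv h s) s :=
      fun h => h.eventually_analyticAt.mono fun s hs => hs.differentiableAt.hasDerivAt
    refine second_deriv_of_relation (X := X)
      (E := fun s => Real.exp (-(a₃ * X s + a₆ / 2 * X s ^ 2))) hX0 (by simp [hX0]) hm0
      (hev.mono fun s hs => hs.2.1) (hev.mono fun s hs => ?_) (hd hm) (hd hm.deriv)
      (hd hm.deriv.deriv).self_of_nhds (hev.mono fun s hs => hs.2.2)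
    exact (((hF (X s)).comp s hs.2.1).neg.exp).congr_deriv (by
      simp only [Pi.neg_apply, Function.comp_apply]; ring)
  have hmpos : ∀ᶠ s in 𝓝 (0 : ℝ), 0 < m s :=
    hm.continuousAt.eventually_const_lt (by rw [hm0]; norm_num)
  obtain ⟨ε₀, hε₀, hball⟩ := Metric.eventually_nhds_iff_ball.1
    (hev.and (hmpos.and hm.eventually_analyticAt))
  simp only [Real.ball_eq_Ioo, zero_sub, zero_add] at hball
  have hmc : ContinuousOn m (Ioo (-ε₀) ε₀) := fun s hs =>
    (hball s hs).2.2.continuousAt.continuousWithinAt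
  refine ⟨ε₀, hε₀, hmc, fun ε hε => ?_⟩
  have hXmono : StrictMonoOn X (Ioo (-ε₀) ε₀) :=
    strictMonoOn_of_deriv_pos (convex_Ioo _ _)
      (fun s hs => (hball s hs).1.2.1.continuousAt.continuousWithinAt) fun s hs => by
        rw [interior_Ioo] at hs
        rw [(hball s hs).1.2.1.deriv]
        exact mul_pos (hball s hs).2.1 (Real.exp_pos _)
  have h0mem : (0 : ℝ) ∈ Ioo (-ε₀) ε₀ := ⟨by linarith, hε₀⟩
  have hεmem : ε ∈ Ioo (-ε₀) ε₀ := ⟨by linarith [hε.1], hε.2⟩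
  have hsub : Ioo 0 ε ⊆ Ioo (-ε₀) ε₀ := fun s hs => ⟨by linarith [hs.1], hs.2.trans hε.2⟩
  have hsurj : ∀ x ∈ Ioo 0 (X ε), ∃ s ∈ Ioo 0 ε, X s = x := fun x hx => by
    have := intermediate_value_Ioo hε.1.le (f := X) fun s hs =>
      (hball s ⟨by linarith [hs.1], hs.2.trans_lt hε.2⟩).1.2.1.continuousAt.continuousWithinAt
    rw [hX0] at this
    exact this hx
  have hmaps : MapsTo S (Ioo 0 (X ε)) (Ioo 0 ε) := fun x hx => by
    obtain ⟨s, hs, rfl⟩ := hsurj x hx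
    rwa [(hball s (hsub hs)).1.1]
  have hXS : ∀ x ∈ Ioo 0 (X ε), X (S x) = x := fun x hx => by
    obtain ⟨s, hs, rfl⟩ := hsurj x hx
    rw [(hball s (hsub hs)).1.1]
  have hXpos : ∀ r ∈ Ioo 0 ε, X r ∈ Ioo 0 (X ε) := fun r hr =>
    ⟨hX0 ▸ hXmono h0mem (hsub hr) hr.1, hXmono (hsub hr) hεmem hr.2⟩
  have horb := fun r (hr : r ∈ Ioo 0 ε) => exists_periodic_orbit
    (g := fun x => x + a₁ * x ^ 2 + a₄ * x ^ 3) (r := r) hF hmc (fun s hs => (hball s hs).2.1)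
    hXmono.injOn (fun s hs => (hball s hs).1.2.1) (fun s hs => (hball s hs).1.2.2)
    ⟨hr.1, hr.2.trans hε.2⟩
  have hV : (fun p : ℝ × ℝ => (-p.2, p.1 + a₁ * p.1 ^ 2 + a₄ * p.1 ^ 3 +
      (a₃ + a₆ * p.1) * p.2 ^ 2)) = kuklesField a₁ a₃ a₄ a₆ := by
    funext p
    simp only [kuklesField, Prod.mk.injEq, true_and]
    ring
  have hV' : (fun (_ : ℝ) (p : ℝ × ℝ) => (-p.2, p.1 + a₁ * p.1 ^ 2 + a₄ * p.1 ^ 3 +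
      (a₃ + a₆ * p.1) * p.2 ^ 2)) = fun _ => kuklesField a₁ a₃ a₄ a₆ := by
    rw [← hV]
  simp only [hV'] at horb
  have hfill : ∃ U ∈ 𝓝 (0 : ℝ × ℝ), ∀ p ∈ U, p ≠ 0 → ∃ r ∈ Ioo 0 ε, ∃ θ,
      p = (X (r * Real.cos θ),
        Real.exp (-(a₃ * X (r * Real.cos θ) + a₆ / 2 * X (r * Real.cos θ) ^ 2)) *
          (r * Real.sin θ)) := by
    set w : ℝ × ℝ → ℝ := fun p => Real.exp (a₃ * p.1 + a₆ / 2 * p.1 ^ 2) * p.2 with hw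
    have hfst : Filter.Tendsto Prod.fst (𝓝 (0 : ℝ × ℝ)) (𝓝 0) :=
      (continuous_fst (X := ℝ) (Y := ℝ)).tendsto 0
    have hSt : Filter.Tendsto (fun p : ℝ × ℝ => S p.1) (𝓝 0) (𝓝 0) := by
      have := hSc.tendsto
      rw [hS0] at this
      exact this.comp hfst
    have hwt : Filter.Tendsto w (𝓝 0) (𝓝 0) := by
      have : Continuous w := by fun_prop
      simpa [hw] using this.tendsto 0
    have hsq : Filter.Tendsto (fun p : ℝ × ℝ => S p.1 ^ 2 + w p ^ 2) (𝓝 0) (𝓝 0) := by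
      simpa using (hSt.pow 2).add (hwt.pow 2)
    refine ⟨_, (hfst.eventually hl).and
      (hsq.eventually_lt_const (show 0 < ε ^ 2 from pow_pos hε.1 2)), fun p hp hne => ?_⟩
    obtain ⟨hp1, hp2⟩ := hp
    -- The modulus and argument of `s + i w` are the radius and angle of the orbit point.
    set z : ℂ := ⟨S p.1, w p⟩ with hz
    have hz2 : ‖z‖ ^ 2 = S p.1 ^ 2 + w p ^ 2 := by
      rw [Complex.sq_norm, Complex.normSq_mk]; ring
    have hzne : z ≠ 0 := fun h => hne <| by
      have h1 : S p.1 = 0 := congrArg Complex.re h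
      have h2 : w p = 0 := congrArg Complex.im h
      rw [h1, hX0] at hp1
      exact Prod.ext hp1.symm ((mul_eq_zero.1 h2).resolve_left (Real.exp_pos _).ne')
    have hzε : ‖z‖ < ε := by
      rw [← hz2] at hp2
      exact lt_of_pow_lt_pow_left₀ 2 hε.1.le hp2
    refine ⟨‖z‖, ⟨norm_pos_iff.2 hzne, hzε⟩, Complex.arg z, ?_⟩
    rw [Complex.norm_mul_cos_arg, Complex.norm_mul_sin_arg]
    refine Prod.ext hp1.symm ?_
    simp only [hz, hw, hp1]
    rw [← mul_assoc, ← Real.exp_add, neg_add_cancel, Real.exp_zero, one_mul]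
  have hVzero : kuklesField a₁ a₃ a₄ a₆ 0 = 0 := by simp [kuklesField]
  obtain ⟨U, hU, hUp⟩ := hfill
  refine ⟨X ε, hX0 ▸ hXmono h0mem hεmem hε.1, S, ?_, hmaps, ⟨fun x hx => ?_, U, hU,
    fun p hp hne => ?_⟩, hVzero, U, hU, fun p hp hne => ?_⟩
  · intro x hx y hy hxy
    rw [← hXmono.lt_iff_lt (hsub (hmaps hx)) (hsub (hmaps hy)), hXS x hx, hXS y hy]
    exact hxy
  · obtain ⟨γ, hγ, hγ0, hleast, -⟩ := horb (S x) (hmaps hx)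
    rw [hXS x hx] at hγ0
    exact ⟨γ, hγ, hγ0, hleast⟩
  · obtain ⟨r, hr, θ, rfl⟩ := hUp p hp hne
    obtain ⟨γ, hγ, hγ0, -, hγθ⟩ := horb r hr
    exact ⟨X r, hXpos r hr, γ, hγ, hγ0, hγθ θ⟩
  · obtain ⟨r, hr, θ, rfl⟩ := hUp p hp hne
    obtain ⟨γ, hγ, -, hleast, hγθ⟩ := horb r hr
    obtain ⟨t, ht⟩ := hγθ θ
    exact ⟨_, ht ▸ IsMinimalPeriod.of_orbit hγ hleast t⟩

theorem mainTheorem10 (a₁ a₃ a₄ a₆ : ℝ) :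
    IsCenterAtZero (kuklesField a₁ a₃ a₄ a₆) ∧
    (0 < kuklesS a₁ a₃ a₄ a₆ → PeriodIncreasingAtZero (kuklesField a₁ a₃ a₄ a₆)) ∧
    (kuklesS a₁ a₃ a₄ a₆ < 0 → PeriodDecreasingAtZero (kuklesField a₁ a₃ a₄ a₆)) := by
  obtain ⟨m, hm, hm2, ε₀, hε₀, hmc, H⟩ := exists_periodFunction a₁ a₃ a₄ a₆
  have hsub : ∀ {ε}, ε ≤ ε₀ → Ioo (-ε) ε ⊆ Ioo (-ε₀) ε₀ := fun h =>
    Ioo_subset_Ioo (neg_le_neg h) h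
  refine ⟨?_, fun hS => ?_, fun hS => ?_⟩
  · obtain ⟨-, -, -, -, -, -, h⟩ := H (ε₀ / 2) ⟨by positivity, by linarith⟩
    exact h
  · obtain ⟨ε₁, hε₁, hmono⟩ := strictMonoOn_add_comp_neg hm (by rw [hm2]; positivity)
    -- Halving keeps the radius strictly below `ε₀`, as `H` requires.
    have hlt : min ε₀ ε₁ / 2 < min ε₀ ε₁ := half_lt_self (lt_min hε₀ hε₁)
    obtain ⟨δ, hδ, S, hSm, hSmaps, hper, -⟩ := H (min ε₀ ε₁ / 2)
      ⟨half_pos (lt_min hε₀ hε₁), hlt.trans_le (min_le_left _ _)⟩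
    refine ⟨δ, hδ, _, hper, ?_⟩
    exact (strictMonoOn_integral_cos (hmc.mono (hsub (hlt.le.trans (min_le_left _ _))))
      (hmono.mono (Ico_subset_Ico_right (hlt.le.trans (min_le_right _ _))))).comp hSm hSmaps
  · have hm2' : 0 < deriv (deriv fun s => -m s) 0 := by
      simp only [deriv.fun_neg', hm2]
      linarith
    obtain ⟨ε₁, hε₁, hmono⟩ := strictMonoOn_add_comp_neg hm.neg hm2'
    have hlt : min ε₀ ε₁ / 2 < min ε₀ ε₁ := half_lt_self (lt_min hε₀ hε₁)
    obtain ⟨δ, hδ, S, hSm, hSmaps, hper, -⟩ := H (min ε₀ ε₁ / 2)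
      ⟨half_pos (lt_min hε₀ hε₁), hlt.trans_le (min_le_left _ _)⟩
    refine ⟨δ, hδ, _, hper, ?_⟩
    exact (strictAntiOn_integral_cos (hmc.mono (hsub (hlt.le.trans (min_le_left _ _))))
      (hmono.mono (Ico_subset_Ico_right (hlt.le.trans (min_le_right _ _))))).comp_strictMonoOn
        hSm hSmaps
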